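/- Let $\mathbb{T}=\{z\in\mathbb{C}:|z|=1\}$; by a measure on $\mathbb{T}$ we mean a finite positive Borel measure, and it is called continuous if it has no atoms. For measures $\nu_1,\dots,\nu_n$ on $\mathbb{T}$ let $\nu_1\ast\cdots\ast\nu_n$ be the image of $\nu_1\otimes\cdots\otimes\nu_n$ under $(z_1,\dots,z_n)\mapsto z_1\cdots z_n$, and let $\sigma^{\ast k}=\sigma\ast\cdots\ast\sigma$ ($k$ factors). A measure $\mu$ on $\mathbb{T}$ has the CS($n$) property if $\mu\perp\nu_1\ast\cdots\ast\nu_n$ for all continuous measures $\nu_1,\dots,\nu_n$ on $\mathbb{T}$. For a unitary operator $U$ on a Hilbert space $H$, let $U^{\odot n}$ be the restriction of $U^{\otimes n}$ to the closed subspace $H^{\odot n}\subset H^{\otimes n}$ of tensors that are invariant under all permutations $x_1\otimes\cdots\otimes x_n\mapsto x_{\pi(1)}\otimes\cdots\otimes x_{\pi(n)}$, where $H^{\otimes n}$ is the Hilbert space tensor power. For $x\in H$ let $\mathbb{Z}(x)$ be the closed linear span of $\{U^jx:j\in\mathbb{Z}\}$, and let the spectral measure $\sigma_x$ be the measure on $\mathbb{T}$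 with $\langle U^jx,x\rangle=\int_{\mathbb{T}}z^j\,d\sigma_x(z)$ for all $j\in\mathbb{Z}$. The operator $U$ has simple spectrum if there is an orthogonal decomposition $H=\bigoplus_{i\ge 1}\mathbb{Z}(x_i)$ with $\sigma_{x_1}\gg\sigma_{x_2}\gg\cdots$ whose multiplicity function $z\mapsto\#\{i\ge1:\frac{d\sigma_{x_i}}{d\sigma_{x_1}}(z)\ne0\}$ equals $1$ $\sigma_{x_1}$-almost everywhere. Let $\sigma$ be a continuous measure on $\mathbb{T}$, let $V_\sigma$ be the unitary operator $(V_\sigma f)(z)=zf(z)$ on $L^2(\mathbb{T},\sigma)$, and let $m,k\ge 1$ be integers such that $V_\sigma^{\odot mk}$ has simple spectrum. Then $\sigma^{\ast k}$ has the CS($n$) property for every natural number $n$ such that $$(m!)^n>\frac{(mk)!}{(k!)^m}.$$ -/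

import Mathlib

noncomputable section

open MeasureTheory
open scoped ComplexConjugate ComplexOrder TensorProduct

/-! ### Measures on the circle -/

/-- The circle group `𝕋 = {z ∈ ℂ : |z| = 1}` carries its Borel σ-algebra. -/
instance Circle.instMeasurableSpaceBorel : MeasurableSpace Circle := borel Circle

instance Circle.instBorelSpaceBorel : BorelSpace Circle := ⟨rfl⟩

namespace ConvSing

/-- The convolution `ν₁ ∗ ⋯ ∗ νₙ` of finite measures on the circle: the image of
`ν₁ ⊗ ⋯ ⊗ νₙ` under `(z₁, …, zₙ) ↦ z₁ ⋯ zₙ`. -/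
def conv {n : ℕ} (ν : Fin n → Measure Circle) : Measure Circle :=
  (Measure.pi ν).map fun z => ∏ i, z i

/-- The convolution power `σ ∗ ⋯ ∗ σ` (`k` factors). -/
def convPow (σ : Measure Circle) (k : ℕ) : Measure Circle :=
  conv fun _ : Fin k => σ

/-- Convolution singularity of order `n`: `σ` is singular to the convolution of any `n`
continuous (that is, atomless) finite measures on the circle. -/
def CS (n : ℕ) (σ : Measure Circle) : Prop :=
  ∀ ν : Fin n → Measure Circle, (∀ i, IsFiniteMeasure (ν i)) → (∀ i, NullSingletonClass (ν i)) →
    Measure.MutuallySingular σ (conv ν)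

/-! ### Spectral theory of a unitary operator -/

section Spectral

variable {H : Type*} [NormedAddCommGroup H] [InnerProductSpace ℂ H]

/-- The cyclic space generated by `x`: the closed linear span of the `Uⁿ x`, `n ∈ ℤ`. -/
def cyclicSpace (U : H ≃ₗᵢ[ℂ] H) (x : H) : Submodule ℂ H :=
  (Submodule.span ℂ (Set.range fun n : ℤ => (U ^ n) x)).topologicalClosure

/-- `μ` is the spectral measure of `x`: the finite measure with `⟨Uⁿ x, x⟩ = ∫ zⁿ dμ(z)` for all
`n ∈ ℤ`. (Mathlib's inner product is linear in the second variable.) -/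
structure IsSpectralMeasure (U : H ≃ₗᵢ[ℂ] H) (x : H) (μ : Measure Circle) : Prop where
  finite : IsFiniteMeasure μ
  fourier : ∀ n : ℤ, inner ℂ x ((U ^ n) x) = ∫ z : Circle, (z : ℂ) ^ n ∂μ

/-- A spectral decomposition `H = ⨁ₙ ℤ(xₙ)` (orthogonal Hilbert sum of cyclic spaces) with
`σ_{x₀} ≫ σ_{x₁} ≫ ⋯`, where `μ n` is the spectral measure of `x n`. -/
structure IsSpectralDecomposition (U : H ≃ₗᵢ[ℂ] H) (x : ℕ → H) (μ : ℕ → Measure Circle) :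
    Prop where
  spectral : ∀ n, IsSpectralMeasure U (x n) (μ n)
  orthogonal : Pairwise fun i j => cyclicSpace U (x i) ⟂ cyclicSpace U (x j)
  total : (⨆ n, cyclicSpace U (x n)).topologicalClosure = ⊤
  chain : ∀ n, μ (n + 1) ≪ μ n

/-- The spectral multiplicity function `M(z) = ∑ₙ 1_{Aₙ}(z)`, where
`Aₙ = {z : (dσ_{xₙ}/dσ_{x₀})(z) ≠ 0}`. -/
def multiplicity (μ : ℕ → Measure Circle) (z : Circle) : ℕ∞ :=
  {n : ℕ | (μ n).rnDeriv (μ 0) z ≠ 0}.encard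

/-- `U` has homogeneous spectrum of multiplicity `N`: the spectral multiplicity function equals `N`
almost everywhere with respect to the maximal spectral type. -/
def HasHomogeneousSpectrum (U : H ≃ₗᵢ[ℂ] H) (N : ℕ) : Prop :=
  ∃ (x : ℕ → H) (μ : ℕ → Measure Circle), IsSpectralDecomposition U x μ ∧
    ∀ᵐ z ∂(μ 0), multiplicity μ z = (N : ℕ∞)

/-- `U` has simple spectrum: it has homogeneous spectrum of multiplicity one. -/
def HasSimpleSpectrum (U : H ≃ₗᵢ[ℂ] H) : Prop := HasHomogeneousSpectrum U 1

end Spectral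

/-! ### The operator `V_σ` -/

theorem memLp_circle_mul (σ : Measure Circle) (u : Circle → Circle) (hu : Continuous u)
    (f : Lp ℂ 2 σ) : MemLp (fun z => (u z : ℂ) * f z) 2 σ := by
  have hm : AEStronglyMeasurable (fun z => (u z : ℂ)) σ :=
    (by fun_prop : Continuous fun z => (u z : ℂ)).aestronglyMeasurable
  refine (Lp.memLp f).of_le (hm.mul (Lp.aestronglyMeasurable f)) (ae_of_all _ fun z => ?_)
  rw [norm_mul, Circle.norm_coe, one_mul]

/-- Multiplication by `z` on `L²(𝕋, σ)`: the unitary operator `(V_σ f)(z) = z f(z)`. -/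
def V (σ : Measure Circle) : Lp ℂ 2 σ ≃ₗᵢ[ℂ] Lp ℂ 2 σ where
  toFun f := (memLp_circle_mul σ (fun z => z) continuous_id f).toLp _
  invFun f := (memLp_circle_mul σ (fun z => z⁻¹) continuous_inv f).toLp _
  map_add' f g := by
    apply Lp.ext
    filter_upwards [MemLp.coeFn_toLp (memLp_circle_mul σ (fun z => z) continuous_id f),
      MemLp.coeFn_toLp (memLp_circle_mul σ (fun z => z) continuous_id g),
      MemLp.coeFn_toLp (memLp_circle_mul σ (fun z => z) continuous_id (f + g)),
      Lp.coeFn_add f g,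
      Lp.coeFn_add ((memLp_circle_mul σ (fun z => z) continuous_id f).toLp _)
        ((memLp_circle_mul σ (fun z => z) continuous_id g).toLp _)] with z h1 h2 h3 h4 h5
    rw [h5, h3, Pi.add_apply, h1, h2, h4, Pi.add_apply, mul_add]
  map_smul' c f := by
    apply Lp.ext
    filter_upwards [MemLp.coeFn_toLp (memLp_circle_mul σ (fun z => z) continuous_id f),
      MemLp.coeFn_toLp (memLp_circle_mul σ (fun z => z) continuous_id (c • f)),
      Lp.coeFn_smul c f,
      Lp.coeFn_smul c ((memLp_circle_mul σ (fun z => z) continuous_id f).toLp _)]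
      with z h1 h2 h3 h4
    rw [RingHom.id_apply, h4, h2, Pi.smul_apply, h1, h3, Pi.smul_apply, smul_eq_mul, smul_eq_mul,
      mul_left_comm]
  left_inv f := by
    apply Lp.ext
    filter_upwards [MemLp.coeFn_toLp (memLp_circle_mul σ (fun z => z) continuous_id f),
      MemLp.coeFn_toLp (memLp_circle_mul σ (fun z => z⁻¹) continuous_inv
        ((memLp_circle_mul σ (fun z => z) continuous_id f).toLp _))] with z h1 h2
    rw [h2, h1, ← mul_assoc, ← Circle.coe_mul, inv_mul_cancel, Circle.coe_one, one_mul]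
  right_inv f := by
    apply Lp.ext
    filter_upwards [MemLp.coeFn_toLp (memLp_circle_mul σ (fun z => z⁻¹) continuous_inv f),
      MemLp.coeFn_toLp (memLp_circle_mul σ (fun z => z) continuous_id
        ((memLp_circle_mul σ (fun z => z⁻¹) continuous_inv f).toLp _))] with z h1 h2
    rw [h2, h1, ← mul_assoc, ← Circle.coe_mul, mul_inv_cancel, Circle.coe_one, one_mul]
  norm_map' f := by
    change ‖(memLp_circle_mul σ (fun z => z) continuous_id f).toLp _‖ = ‖f‖
    rw [Lp.norm_toLp, Lp.norm_def]
    congr 1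
    exact eLpNorm_congr_norm_ae (ae_of_all _ fun z => by rw [norm_mul, Circle.norm_coe, one_mul])

theorem V_apply (σ : Measure Circle) (f : Lp ℂ 2 σ) :
    ∀ᵐ z ∂σ, V σ f z = (z : ℂ) * f z :=
  MemLp.coeFn_toLp (memLp_circle_mul σ (fun z => z) continuous_id f)

/-! ### Tensor powers of a Hilbert space -/

section Tensor

variable (n : ℕ) (H : Type*) [NormedAddCommGroup H] [InnerProductSpace ℂ H]

/-- The algebraic tensor power `H ⊗ ⋯ ⊗ H` (`n` factors). It is a type synonym since it will carry
the Hilbertian norm and not the projective one. -/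
def AlgTensor : Type _ := ⨂[ℂ] _ : Fin n, H

instance AlgTensor.instAddCommGroup : AddCommGroup (AlgTensor n H) :=
  inferInstanceAs (AddCommGroup (⨂[ℂ] _ : Fin n, H))

instance AlgTensor.instModule : Module ℂ (AlgTensor n H) :=
  inferInstanceAs (Module ℂ (⨂[ℂ] _ : Fin n, H))

variable {n H}

/-- The simple tensor `x₁ ⊗ ⋯ ⊗ xₙ`. -/
def AlgTensor.tmul (x : Fin n → H) : AlgTensor n H := PiTensorProduct.tprod ℂ x

theorem AlgTensor.induction {p : AlgTensor n H → Prop} (t : AlgTensor n H)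
    (smul_tmul : ∀ (c : ℂ) (x : Fin n → H), p (c • AlgTensor.tmul x))
    (add : ∀ s t, p s → p t → p (s + t)) : p t :=
  PiTensorProduct.induction_on (motive := p) t smul_tmul add

/-- The linear functional `x₁ ⊗ ⋯ ⊗ xₙ ↦ ∏ ⟨yᵢ, xᵢ⟩`. -/
def AlgTensor.innerLeft (y : Fin n → H) : AlgTensor n H →ₗ[ℂ] ℂ :=
  PiTensorProduct.lift
    ((MultilinearMap.mkPiAlgebra ℂ (Fin n) ℂ).compLinearMap fun i => innerₛₗ ℂ (y i))

theorem AlgTensor.innerLeft_tmul (y x : Fin n → H) :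
    AlgTensor.innerLeft y (AlgTensor.tmul x) = ∏ i, inner ℂ (y i) (x i) := by
  refine (PiTensorProduct.lift.tprod _).trans ?_
  simp

/-- The sesquilinear form with `⟨x₁ ⊗ ⋯ ⊗ xₙ, y₁ ⊗ ⋯ ⊗ yₙ⟩ = ∏ ⟨xᵢ, yᵢ⟩`, linear in `y`, as a map
`y ↦ (x ↦ ⟨x, y⟩)`. -/
def AlgTensor.form : AlgTensor n H →ₗ[ℂ] (AlgTensor n H →ₗ⋆[ℂ] ℂ) :=
  PiTensorProduct.lift
    { toFun := fun y =>
        { toFun := fun t => conj (AlgTensor.innerLeft y t)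
          map_add' := fun s t => by simp
          map_smul' := fun c t => by simp }
      map_update_add' := by
        intro _ y i a b
        ext t
        induction t using AlgTensor.induction with
        | smul_tmul c x =>
          simp only [LinearMap.coe_mk, AddHom.coe_mk, LinearMap.add_apply, map_smul,
            AlgTensor.innerLeft_tmul, smul_eq_mul, map_mul, map_prod, inner_conj_symm]
          rw [← mul_add]
          congr 1
          have := ((MultilinearMap.mkPiAlgebra ℂ (Fin n) ℂ).compLinearMap
            fun i => innerₛₗ ℂ (x i)).map_update_add y i a b
          simpa only [MultilinearMap.compLinearMap_apply, MultilinearMap.mkPiAlgebra_apply,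
            innerₛₗ_apply_apply, smul_eq_mul] using this
        | add s t hs ht =>
          rw [map_add, map_add, hs, ht]
      map_update_smul' := by
        intro _ y i a b
        ext t
        induction t using AlgTensor.induction with
        | smul_tmul c x =>
          simp only [LinearMap.coe_mk, AddHom.coe_mk, LinearMap.smul_apply, map_smul,
            AlgTensor.innerLeft_tmul, smul_eq_mul, map_mul, map_prod, inner_conj_symm]
          rw [mul_left_comm]
          congr 1
          have := ((MultilinearMap.mkPiAlgebra ℂ (Fin n) ℂ).compLinearMap
            fun i => innerₛₗ ℂ (x i)).map_update_smul y i a b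
          simpa only [MultilinearMap.compLinearMap_apply, MultilinearMap.mkPiAlgebra_apply,
            innerₛₗ_apply_apply, smul_eq_mul] using this
        | add s t hs ht =>
          rw [map_add, map_add, hs, ht] }

theorem AlgTensor.form_tmul (x y : Fin n → H) :
    AlgTensor.form (AlgTensor.tmul y) (AlgTensor.tmul x) = ∏ i, inner ℂ (x i) (y i) := by
  have : AlgTensor.form (AlgTensor.tmul y) (AlgTensor.tmul x) =
      conj (AlgTensor.innerLeft y (AlgTensor.tmul x)) := by
    simp only [AlgTensor.form, AlgTensor.tmul]
    erw [PiTensorProduct.lift.tprod]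
    rfl
  rw [this, AlgTensor.innerLeft_tmul, map_prod]
  simp only [inner_conj_symm]

theorem AlgTensor.form_conj (s t : AlgTensor n H) :
    conj (AlgTensor.form s t) = AlgTensor.form t s := by
  induction s using AlgTensor.induction with
  | smul_tmul c x =>
    induction t using AlgTensor.induction with
    | smul_tmul d y =>
      simp only [map_smul, LinearMap.map_smulₛₗ, LinearMap.smul_apply, AlgTensor.form_tmul,
        smul_eq_mul, map_mul, map_prod, inner_conj_symm, Complex.conj_conj]
      ring
    | add s t hs ht => simp only [map_add, LinearMap.add_apply, hs, ht]
  | add s t hs ht => simp only [map_add, LinearMap.add_apply, hs, ht]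

theorem AlgTensor.posSemidef_prod_gram {ι : Type*} [Finite ι] (x : ι → Fin n → H)
    (s : Finset (Fin n)) :
    (Matrix.of fun a b => ∏ i ∈ s, inner ℂ (x a i) (x b i) : Matrix ι ι ℂ).PosSemidef := by
  classical
  induction s using Finset.induction_on with
  | empty =>
    have h : (Matrix.of fun a b => ∏ i ∈ ∅, inner ℂ (x a i) (x b i) : Matrix ι ι ℂ) =
        Matrix.gram ℂ (fun _ : ι => (1 : ℂ)) := by
      ext a b
      simp [Matrix.gram]
    rw [h]
    exact Matrix.posSemidef_gram ℂ _
  | insert i s hi ih =>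
    have h : (Matrix.of fun a b => ∏ i ∈ insert i s, inner ℂ (x a i) (x b i) : Matrix ι ι ℂ) =
        (Matrix.gram ℂ (fun a => x a i)).hadamard
          (Matrix.of fun a b => ∏ i ∈ s, inner ℂ (x a i) (x b i)) := by
      ext a b
      simp [Matrix.gram, Finset.prod_insert hi]
    rw [h]
    exact (Matrix.posSemidef_gram ℂ _).hadamard ih

theorem AlgTensor.form_self_nonneg (t : AlgTensor n H) : 0 ≤ (AlgTensor.form t t).re := by
  have ht : t ∈ Submodule.span ℂ (Set.range (AlgTensor.tmul : (Fin n → H) → AlgTensor n H)) := by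
    have := PiTensorProduct.span_tprod_eq_top (R := ℂ) (s := fun _ : Fin n => H)
    exact this ▸ Submodule.mem_top (x := t)
  obtain ⟨c, rfl⟩ := Finsupp.mem_span_range_iff_exists_finsupp.1 ht
  have key := (AlgTensor.posSemidef_prod_gram (fun a : c.support => (a : Fin n → H))
    Finset.univ).dotProduct_mulVec_nonneg (fun a => c a)
  have hre := (Complex.nonneg_iff.1 key).1
  refine hre.trans_eq ?_
  congr 1
  simp only [Finsupp.sum, map_sum, map_smul, LinearMap.sum_apply, LinearMap.smul_apply,
    LinearMap.map_smulₛₗ, AlgTensor.form_tmul, dotProduct, Matrix.mulVec, Matrix.of_apply,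
    smul_eq_mul, Pi.star_apply, Finset.mul_sum]
  rw [← Finset.sum_coe_sort c.support]
  refine Finset.sum_congr rfl fun b _ => ?_
  rw [← Finset.sum_coe_sort c.support]
  refine Finset.sum_congr rfl fun a _ => ?_
  simp only [Complex.star_def]
  ring

variable (n H) in
/-- The semi-inner product on the algebraic tensor power. -/
@[reducible]
def AlgTensor.core : PreInnerProductSpace.Core ℂ (AlgTensor n H) where
  inner s t := AlgTensor.form t s
  conj_inner_symm s t := AlgTensor.form_conj s t
  re_inner_nonneg t := AlgTensor.form_self_nonneg t
  add_left s t r := map_add (AlgTensor.form r) s t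
  smul_left s t c := (AlgTensor.form t).map_smulₛₗ c s

instance AlgTensor.instSeminormedAddCommGroup : SeminormedAddCommGroup (AlgTensor n H) :=
  @InnerProductSpace.Core.toSeminormedAddCommGroup ℂ _ _ _ _ (AlgTensor.core n H)

instance AlgTensor.instInnerProductSpace : InnerProductSpace ℂ (AlgTensor n H) :=
  InnerProductSpace.ofCore (AlgTensor.core n H)

theorem AlgTensor.inner_tmul (x y : Fin n → H) :
    inner ℂ (AlgTensor.tmul x) (AlgTensor.tmul y) = ∏ i, inner ℂ (x i) (y i) :=
  AlgTensor.form_tmul x y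

theorem AlgTensor.norm_map_of_tmul (e : AlgTensor n H →ₗ[ℂ] AlgTensor n H)
    (he : ∀ x y : Fin n → H, inner ℂ (e (AlgTensor.tmul x)) (e (AlgTensor.tmul y)) =
      inner ℂ (AlgTensor.tmul x) (AlgTensor.tmul y)) (t : AlgTensor n H) : ‖e t‖ = ‖t‖ := by
  have key : ∀ s t : AlgTensor n H, inner ℂ (e s) (e t) = inner ℂ s t := by
    intro s t
    induction s using AlgTensor.induction with
    | smul_tmul c x =>
      induction t using AlgTensor.induction with
      | smul_tmul d y => simp only [map_smul, inner_smul_left, inner_smul_right, he]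
      | add s t hs ht => simp only [map_add, inner_add_right, hs, ht]
    | add s t hs ht => simp only [map_add, inner_add_left, hs, ht]
  rw [norm_eq_sqrt_re_inner (𝕜 := ℂ), norm_eq_sqrt_re_inner (𝕜 := ℂ), key]

/-- `U ⊗ ⋯ ⊗ U` on the algebraic tensor power. -/
def AlgTensor.map (U : H ≃ₗᵢ[ℂ] H) (n : ℕ) : AlgTensor n H ≃ₗᵢ[ℂ] AlgTensor n H :=
  let e : AlgTensor n H ≃ₗ[ℂ] AlgTensor n H :=
    PiTensorProduct.congr fun _ : Fin n => U.toLinearEquiv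
  have he : ∀ x : Fin n → H, e (AlgTensor.tmul x) = AlgTensor.tmul fun i => U (x i) :=
    fun x => PiTensorProduct.congr_tprod (fun _ : Fin n => U.toLinearEquiv) x
  ⟨e, AlgTensor.norm_map_of_tmul e.toLinearMap fun x y => by
    simp only [LinearEquiv.coe_coe, he, AlgTensor.inner_tmul, LinearIsometryEquiv.inner_map_map]⟩

theorem AlgTensor.map_tmul (U : H ≃ₗᵢ[ℂ] H) (x : Fin n → H) :
    AlgTensor.map U n (AlgTensor.tmul x) = AlgTensor.tmul fun i => U (x i) :=
  PiTensorProduct.congr_tprod (fun _ : Fin n => U.toLinearEquiv) x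

variable (H) in
/-- The permutation `x₁ ⊗ ⋯ ⊗ xₙ ↦ x_{π(1)} ⊗ ⋯ ⊗ x_{π(n)}` of the algebraic tensor power. -/
def AlgTensor.perm (π : Equiv.Perm (Fin n)) : AlgTensor n H ≃ₗᵢ[ℂ] AlgTensor n H :=
  let e : AlgTensor n H ≃ₗ[ℂ] AlgTensor n H :=
    PiTensorProduct.reindex ℂ (fun _ : Fin n => H) π.symm
  have he : ∀ x : Fin n → H, e (AlgTensor.tmul x) = AlgTensor.tmul fun i => x (π i) :=
    fun x => PiTensorProduct.reindex_tprod π.symm x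
  ⟨e, AlgTensor.norm_map_of_tmul e.toLinearMap fun x y => by
    simp only [LinearEquiv.coe_coe, he, AlgTensor.inner_tmul]
    exact Equiv.prod_comp π fun i => inner ℂ (x i) (y i)⟩

theorem AlgTensor.perm_tmul (π : Equiv.Perm (Fin n)) (x : Fin n → H) :
    AlgTensor.perm H π (AlgTensor.tmul x) = AlgTensor.tmul fun i => x (π i) :=
  PiTensorProduct.reindex_tprod π.symm x

theorem AlgTensor.map_perm (U : H ≃ₗᵢ[ℂ] H) (π : Equiv.Perm (Fin n)) (t : AlgTensor n H) :
    AlgTensor.map U n (AlgTensor.perm H π t) = AlgTensor.perm H π (AlgTensor.map U n t) := by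
  induction t using AlgTensor.induction with
  | smul_tmul c x => simp only [map_smul, AlgTensor.perm_tmul, AlgTensor.map_tmul]
  | add s t hs ht => simp only [map_add, hs, ht]

/-- The extension of a surjective linear isometry to the completion. -/
def extendCompletion {E : Type*} [SeminormedAddCommGroup E] [InnerProductSpace ℂ E]
    (e : E ≃ₗᵢ[ℂ] E) :
    UniformSpace.Completion E ≃ₗᵢ[ℂ] UniformSpace.Completion E where
  toFun := (e : E →L[ℂ] E).completion
  invFun := (e.symm : E →L[ℂ] E).completion
  map_add' := map_add _
  map_smul' := map_smul _
  left_inv x := by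
    induction x using UniformSpace.Completion.induction_on with
    | hp => exact isClosed_eq (by fun_prop) continuous_id
    | ih x => simp
  right_inv x := by
    induction x using UniformSpace.Completion.induction_on with
    | hp => exact isClosed_eq (by fun_prop) continuous_id
    | ih x => simp
  norm_map' x := by
    change ‖(e : E →L[ℂ] E).completion x‖ = ‖x‖
    induction x using UniformSpace.Completion.induction_on with
    | hp => exact isClosed_eq (by fun_prop) (by fun_prop)
    | ih x => simp

theorem extendCompletion_coe {E : Type*} [SeminormedAddCommGroup E] [InnerProductSpace ℂ E]
    (e : E ≃ₗᵢ[ℂ] E) (x : E) :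
    extendCompletion e (x : UniformSpace.Completion E) = (e x : UniformSpace.Completion E) :=
  (e : E →L[ℂ] E).completion_apply_coe x

variable (n H) in
/-- The Hilbert space tensor power: the completion of the algebraic tensor power for the inner
product with `⟨x₁ ⊗ ⋯ ⊗ xₙ, y₁ ⊗ ⋯ ⊗ yₙ⟩ = ∏ ⟨xᵢ, yᵢ⟩`. -/
abbrev HilbertTensor : Type _ := UniformSpace.Completion (AlgTensor n H)

/-- The unitary operator `U ⊗ ⋯ ⊗ U` (`n` factors) on the Hilbert space tensor power. -/
def tensorPow (U : H ≃ₗᵢ[ℂ] H) (n : ℕ) : HilbertTensor n H ≃ₗᵢ[ℂ] HilbertTensor n H :=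
  extendCompletion (AlgTensor.map U n)

variable (H) in
/-- The unitary operator `x₁ ⊗ ⋯ ⊗ xₙ ↦ x_{π(1)} ⊗ ⋯ ⊗ x_{π(n)}` on the Hilbert space tensor
power. -/
def permOp (π : Equiv.Perm (Fin n)) : HilbertTensor n H ≃ₗᵢ[ℂ] HilbertTensor n H :=
  extendCompletion (AlgTensor.perm H π)

theorem tensorPow_permOp (U : H ≃ₗᵢ[ℂ] H) (π : Equiv.Perm (Fin n)) (t : HilbertTensor n H) :
    tensorPow U n (permOp H π t) = permOp H π (tensorPow U n t) := by
  induction t using UniformSpace.Completion.induction_on with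
  | hp =>
    exact isClosed_eq ((tensorPow U n).continuous.comp (permOp H π).continuous)
      ((permOp H π).continuous.comp (tensorPow U n).continuous)
  | ih t =>
    simp only [tensorPow, permOp, extendCompletion_coe, AlgTensor.map_perm]

variable (n H) in
/-- The symmetric tensor power: the tensors invariant under all permutations. -/
def symTensor : Submodule ℂ (HilbertTensor n H) where
  carrier := {t | ∀ π : Equiv.Perm (Fin n), permOp H π t = t}
  add_mem' hs ht π := by rw [map_add, hs π, ht π]
  zero_mem' π := map_zero _
  smul_mem' c t ht π := by rw [map_smul, ht π]

theorem tensorPow_mem_symTensor (U : H ≃ₗᵢ[ℂ] H) {t : HilbertTensor n H}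
    (ht : t ∈ symTensor n H) : tensorPow U n t ∈ symTensor n H := fun π => by
  rw [← tensorPow_permOp, ht π]

theorem tensorPow_symm_mem_symTensor (U : H ≃ₗᵢ[ℂ] H) {t : HilbertTensor n H}
    (ht : t ∈ symTensor n H) : (tensorPow U n).symm t ∈ symTensor n H := fun π => by
  apply (tensorPow U n).injective
  rw [tensorPow_permOp, LinearIsometryEquiv.apply_symm_apply, ht π]

/-- The restriction of `U ⊗ ⋯ ⊗ U` (`n` factors) to the symmetric tensor power. -/
def symPow (U : H ≃ₗᵢ[ℂ] H) (n : ℕ) : symTensor n H ≃ₗᵢ[ℂ] symTensor n H where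
  toFun t := ⟨tensorPow U n t, tensorPow_mem_symTensor U t.2⟩
  invFun t := ⟨(tensorPow U n).symm t, tensorPow_symm_mem_symTensor U t.2⟩
  map_add' s t := Subtype.ext (map_add (tensorPow U n) (s : HilbertTensor n H) t)
  map_smul' c t := Subtype.ext (map_smul (tensorPow U n) c (t : HilbertTensor n H))
  left_inv t := Subtype.ext ((tensorPow U n).symm_apply_apply t)
  right_inv t := Subtype.ext ((tensorPow U n).apply_symm_apply t)
  norm_map' t := (tensorPow U n).norm_map t

end Tensor

end ConvSing

end

noncomputable section

open MeasureTheory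
open scoped ComplexConjugate ComplexOrder TensorProduct

namespace ConvSing

open Set Function Filter Topology

/-! ### Finite products of measures -/

/-! Put `N = m * k`. The proof has an operator half and a measure half.

Operator half (`HasSimpleSpectrum.exists_ae_determined`). Simple spectrum gives a cyclic vector.
Realised in `L²(σ^N)`, the operator multiplies by `p = z₁⋯z_N`, so every symmetric tensor becomes an
a.e. limit of functions `P_l(p) g(z)` with one fixed `g`. Apply this to the tensor powers of `c -
z`, that is, to `∏ (c - zᵢ)`, for all `c ∈ ℕ`. If two points of a suitable full-measure set have the
same `p`, their values differ by a factor independent of `c`; the case `c = 0` shows that the factor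
is 1. Hence the polynomials `∏ (X - zᵢ)` agree and the points differ by a permutation of
coordinates.

Measure half (`CS_convPow_of_ae_determined`). If `σ^{∗k}` is not singular to `ν₁ ∗ ⋯ ∗ νₙ`, sample
an `n × m` array whose row `i` consists of independent points of law `νᵢ`. Each tuple of `n`
permutations of the columns splits the array into `m` transversals, whose products form a point of
`𝕋ᵐ`. With positive probability all these points lift to `𝕋^{mk}` as `k`-block products of points in
the good set. The lifts share the total product of the array, so they are rearrangements of a single
point and yield at most `(mk)!/(k!)ᵐ` block products. Since the rows are atomless, the `(m!)ⁿ`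
points are almost surely distinct, a contradiction. -/

/-- Currying a finite product measure along an equivalence of the index type with a product. -/
theorem pi_map_curry {α ι κ X : Type*} [Fintype α] [Fintype ι] [Fintype κ] [MeasurableSpace X]
    (e : ι × κ ≃ α) (ν : α → Measure X) [∀ a, IsFiniteMeasure (ν a)] :
    (Measure.pi ν).map (fun z i j => z (e (i, j))) =
      Measure.pi fun i => Measure.pi fun j => ν (e (i, j)) := by
  symm
  -- Boxes whose sides are themselves boxes form a generating π-system, and their preimages are
  -- ordinary boxes.
  refine Measure.pi_eq_generateFrom
    (C := fun _ : ι => pi univ '' pi univ fun _ : κ => {s : Set X | MeasurableSet s})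
    (fun _ => generateFrom_pi) (fun _ => isPiSystem_pi)
    (fun i => Measure.FiniteSpanningSetsIn.pi
      fun j => (ν (e (i, j))).toFiniteSpanningSetsIn) fun s hs => ?_
  choose t ht hst using hs
  obtain rfl : (fun i => pi univ (t i)) = s := funext hst
  have hpre : (fun (z : α → X) i j => z (e (i, j))) ⁻¹' pi univ (fun i => pi univ (t i)) =
      pi univ fun a => t (e.symm a).1 (e.symm a).2 := by
    ext z
    simp only [mem_preimage, Set.mem_pi, mem_univ, true_imp_iff]
    refine ⟨fun h a => ?_, fun h i j => ?_⟩
    · simpa using h (e.symm a).1 (e.symm a).2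
    · simpa using h (e (i, j))
  rw [Measure.map_apply (by fun_prop) (MeasurableSet.univ_pi fun i =>
    MeasurableSet.univ_pi fun j => ht i j (mem_univ j)), hpre, Measure.pi_pi,
    ← e.prod_comp, Fintype.prod_prod_type]
  simp [Measure.pi_pi]

/-- A measurable set which meets every line in one atomless direction in at most one point is
null. -/
theorem pi_null_of_subsingleton_update {ι X : Type*} [Fintype ι] [DecidableEq ι]
    [MeasurableSpace X] (μ : ι → Measure X) [∀ i, SigmaFinite (μ i)] (i : ι)
    [NullSingletonClass (μ i)] {S : Set (ι → X)} (hS : MeasurableSet S)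
    (h : ∀ y, {t | update y i t ∈ S}.Subsingleton) : Measure.pi μ S = 0 := by
  rcases isEmpty_or_nonempty (ι → X) with hX | ⟨⟨y₀⟩⟩
  · rw [Set.eq_empty_of_isEmpty S, measure_empty]
  have hf : Measurable (S.indicator (1 : (ι → X) → ENNReal)) := measurable_one.indicator hS
  -- Tonelli with coordinate `i` integrated innermost: each inner integral is the mass of at most
  -- one point.
  rw [← lintegral_indicator_one hS, lintegral_eq_lmarginal_univ y₀,
    ← Finset.insert_erase (Finset.mem_univ i), lmarginal_insert' _ hf (Finset.notMem_erase i _)]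
  have h0 : (fun x => ∫⁻ t, S.indicator (1 : (ι → X) → ENNReal) (update x i t) ∂μ i) = 0 := by
    ext x
    have : (fun t => S.indicator (1 : (ι → X) → ENNReal) (update x i t)) =
        {t | update x i t ∈ S}.indicator 1 := rfl
    refine (congrArg (lintegral (μ i)) this).trans
      ((lintegral_indicator_one (hS.preimage (measurable_update x))).trans ?_)
    exact (h x).measure_zero _
  rw [h0]
  simp [lmarginal]

theorem absolutelyContinuous_pi {X : Type*} [MeasurableSpace X] {m : ℕ} (μ ν : Fin m → Measure X)
    [∀ i, SigmaFinite (μ i)] [∀ i, SigmaFinite (ν i)] (h : ∀ i, μ i ≪ ν i) :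
    Measure.pi μ ≪ Measure.pi ν := by
  induction m with
  | zero => rw [Subsingleton.elim μ ν]
  | succ m ih =>
    have hμ := measurePreserving_piFinSuccAbove μ 0
    have hν := measurePreserving_piFinSuccAbove ν 0
    rw [← (hμ.symm _).map_eq, ← (hν.symm _).map_eq]
    exact ((h 0).prod (ih _ _ fun i => h _)).map (MeasurableEquiv.measurable _)

theorem prod_null_iff_ae_left {X Y : Type*} [MeasurableSpace X] [MeasurableSpace Y]
    (μ : Measure X) (ν : Measure Y) [SFinite μ] [SFinite ν] {S : Set (X × Y)}
    (hS : MeasurableSet S) :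
    μ.prod ν S = 0 ↔ ∀ᵐ y ∂ν, μ ((fun x => (x, y)) ⁻¹' S) = 0 := by
  rw [Measure.prod_apply_symm hS, lintegral_eq_zero_iff (measurable_measure_prodMk_right hS)]
  rfl

/-- If a set `E` has positive measure for a product measure, then with positive probability all
points of a random grid with `m` independent samples in each coordinate lie in `E`. -/
theorem pi_grid_ne_zero {X : Type*} [MeasurableSpace X] {n : ℕ} (m : ℕ) (ν : Fin n → Measure X)
    [∀ i, IsFiniteMeasure (ν i)] {E : Set (Fin n → X)} (hE : MeasurableSet E)
    (hpos : Measure.pi ν E ≠ 0) :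
    Measure.pi (fun i => Measure.pi fun _ : Fin m => ν i)
      {y | ∀ J : Fin n → Fin m, (fun i => y i (J i)) ∈ E} ≠ 0 := by
  induction n with
  | zero =>
    have hE' : ∀ x, x ∈ E := fun x => by
      obtain ⟨x', hx'⟩ := nonempty_of_measure_ne_zero hpos
      rwa [Subsingleton.elim x x']
    simp [hE']
  | succ n ih =>
    have hν := measurePreserving_piFinSuccAbove ν 0
    have hP := measurePreserving_piFinSuccAbove (fun i => Measure.pi fun _ : Fin m => ν i) 0
    set e := MeasurableEquiv.piFinSuccAbove (fun _ : Fin (n + 1) => X) 0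
    set e' := MeasurableEquiv.piFinSuccAbove (fun _ : Fin (n + 1) => Fin m → X) 0
    set ν' : Fin n → Measure X := fun j => ν (Fin.succAbove 0 j)
    have hF : MeasurableSet (e.symm ⁻¹' E) := hE.preimage e.symm.measurable
    set F := e.symm ⁻¹' E
    have hFpos : ((ν 0).prod (Measure.pi ν')) F ≠ 0 := by
      rwa [(hν.symm _).measure_preimage_equiv]
    -- Resample only the first coordinate. Over a fixed remainder the fibre of `G` is the `m`-th
    -- power of the fibre of `F`, so it is null only if that fibre is.
    set G : Set ((Fin m → X) × (Fin n → X)) := {p | ∀ j, (p.1 j, p.2) ∈ F}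
    have hG : MeasurableSet G := by
      simp only [G, ofPred_forall]
      exact MeasurableSet.iInter fun j => hF.preimage (by fun_prop)
    have hGpos : ((Measure.pi fun _ : Fin m => ν 0).prod (Measure.pi ν')) G ≠ 0 := by
      rw [Ne, prod_null_iff_ae_left _ _ hG]
      rw [Ne, prod_null_iff_ae_left _ _ hF] at hFpos
      refine fun h => hFpos (h.mono fun w hw => ?_)
      have : (fun x => (x, w)) ⁻¹' G = pi univ fun _ : Fin m => (fun x => (x, w)) ⁻¹' F := by
        ext x
        simp [G]
      rw [this, Measure.pi_pi, Finset.prod_const] at hw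
      exact eq_zero_of_pow_eq_zero hw
    have hK : MeasurableSet {p : (Fin m → X) × (Fin n → Fin m → X) |
        ∀ J : Fin n → Fin m, (p.1, fun i => p.2 i (J i)) ∈ G} := by
      simp only [ofPred_forall]
      exact MeasurableSet.iInter fun j => hG.preimage (by fun_prop)
    have hsub : e' ⁻¹' {p : (Fin m → X) × (Fin n → Fin m → X) |
        ∀ J : Fin n → Fin m, (p.1, fun i => p.2 i (J i)) ∈ G} ⊆
        {y | ∀ J : Fin (n + 1) → Fin m, (fun i => y i (J i)) ∈ E} := by
      intro y hy J
      have := hy (fun i => J i.succ) (J 0)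
      simp only [F, mem_preimage] at this
      convert this using 1
      ext i
      refine Fin.cases ?_ (fun i => ?_) i <;> simp [e, e', Fin.tail]
    refine fun h0 => ?_
    have h1 := measure_mono_null hsub h0
    rw [hP.measure_preimage_equiv, Measure.measure_prod_null hK] at h1
    rw [Ne, Measure.measure_prod_null hG] at hGpos
    -- If the grid event were null, almost every slice of it would be, and by induction so would
    -- almost every slice of `G`.
    refine hGpos (h1.mono fun x hx => ?_)
    by_contra hne
    exact ih ν' (hG.preimage measurable_prodMk_left) hne hx

/-- If two finite measures are not mutually singular, then the second one restricts to a nonzero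
measure that is absolutely continuous with respect to the first one. -/
theorem exists_restrict_absolutelyContinuous {X : Type*} [MeasurableSpace X] (τ ν : Measure X)
    [IsFiniteMeasure τ] [IsFiniteMeasure ν] (h : ¬ Measure.MutuallySingular τ ν) :
    ∃ B, MeasurableSet B ∧ ν B ≠ 0 ∧ ν.restrict B ≪ τ := by
  have hm := Measure.measurable_rnDeriv τ ν
  -- `B` is where the absolutely continuous part of `τ` has nonzero density. If `B` were `ν`-null,
  -- `τ` would equal its singular part.
  refine ⟨{x | τ.rnDeriv ν x ≠ 0}, hm (measurableSet_singleton 0).compl, fun h0 => h ?_, ?_⟩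
  · have : τ.rnDeriv ν =ᵐ[ν] 0 := h0
    rw [Measure.haveLebesgueDecomposition_add τ ν, withDensity_congr_ae this, withDensity_zero,
      add_zero]
    exact Measure.mutuallySingular_singularPart τ ν
  · refine Measure.AbsolutelyContinuous.trans ?_
      (Measure.absolutelyContinuous_of_le (Measure.withDensity_rnDeriv_le τ ν))
    refine Measure.AbsolutelyContinuous.mk fun s hs h0 => ?_
    rw [withDensity_apply_eq_zero hm] at h0
    rw [Measure.restrict_apply hs, inter_comm]
    exact h0

/-- The image of a set of full measure under a continuous map has full image measure. -/
theorem ae_mem_image_of_continuous {X Y : Type*} [TopologicalSpace X] [MeasurableSpace X]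
    [BorelSpace X] [T2Space X] [TopologicalSpace Y] [MeasurableSpace Y] [BorelSpace Y] [T2Space Y]
    (μ : Measure X) [IsFiniteMeasure μ] [μ.InnerRegularCompactLTTop] {q : X → Y}
    (hq : Continuous q) {A : Set X} (hA : ∀ᵐ x ∂μ, x ∈ A) : ∀ᵐ y ∂μ.map q, y ∈ q '' A := by
  set A' := (toMeasurable μ Aᶜ)ᶜ
  have hA'm : MeasurableSet A' := (measurableSet_toMeasurable μ _).compl
  have hA'A : A' ⊆ A := compl_subset_comm.1 (subset_toMeasurable μ Aᶜ)
  have hA'0 : μ A'ᶜ = 0 := by rw [compl_compl, measure_toMeasurable]; exact hA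
  -- The image of a measurable set need not be Borel; compact subsets exhausting `A'` up to a null
  -- set have closed images.
  have hK : ∀ l : ℕ, ∃ K, K ⊆ A' ∧ IsCompact K ∧ μ (A' \ K) < (l : ENNReal)⁻¹ := fun l =>
    hA'm.exists_isCompact_sdiff_lt (measure_ne_top _ _) (by simp)
  choose K hKA hKc hKμ using hK
  have hS : MeasurableSet (q '' ⋃ l, K l) := by
    rw [image_iUnion]
    exact MeasurableSet.iUnion fun l => ((hKc l).image hq).isClosed.measurableSet
  have hsub : ∀ᵐ x ∂μ, x ∈ ⋃ l, K l := by
    have h1 : μ (A' \ ⋃ l, K l) = 0 := by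
      by_contra hne
      obtain ⟨l, hl⟩ := ENNReal.exists_inv_nat_lt hne
      exact (hl.trans_le (measure_mono (sdiff_subset_sdiff_right (subset_iUnion K l)))).not_gt
        (hKμ l)
    refine measure_mono_null (fun x hx => ?_) (measure_union_null hA'0 h1)
    by_cases hxA : x ∈ A'
    · exact Or.inr ⟨hxA, hx⟩
    · exact Or.inl hxA
  have h2 : ∀ᵐ y ∂μ.map q, y ∈ q '' ⋃ l, K l :=
    (ae_map_iff hq.measurable.aemeasurable hS).2 (hsub.mono fun x hx => mem_image_of_mem q hx)
  exact h2.mono fun y hy => image_mono (iUnion_subset fun l => (hKA l).trans hA'A) hy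

/-! ### Multiplicities of convolutions -/

instance Circle.instSecondCountableTopology : SecondCountableTopology Circle :=
  inferInstanceAs (SecondCountableTopology (Metric.sphere (0 : ℂ) 1))

instance conv.instIsFiniteMeasure {n : ℕ} (ν : Fin n → Measure Circle)
    [∀ i, IsFiniteMeasure (ν i)] : IsFiniteMeasure (conv ν) := by
  unfold conv
  infer_instance

/-- The map `z ↦ (∏ᵢ z(e(j, i)))ⱼ` carries a product measure to a product of convolutions. -/
theorem pi_map_prod_curry {α : Type*} [Fintype α] {m n : ℕ} (e : Fin m × Fin n ≃ α)
    (ν : α → Measure Circle) [∀ a, IsFiniteMeasure (ν a)] :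
    (Measure.pi ν).map (fun z j => ∏ i, z (e (j, i))) =
      Measure.pi fun j => conv fun i => ν (e (j, i)) := by
  have h := Measure.pi_map_pi (μ := fun j => Measure.pi fun i => ν (e (j, i)))
    (f := fun (_ : Fin m) (z : Fin n → Circle) => ∏ i, z i)
    (hμ := fun j => by infer_instance)
    (fun j => by fun_prop)
  rw [← pi_map_curry e ν, Measure.map_map (by fun_prop) (by fun_prop)] at h
  exact h

/-- The products along the transversals of a random array with independent atomless rows are
almost surely distinct. -/
theorem ae_injective_prod_transversal {n m : ℕ} (ν : Fin n → Measure Circle)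
    [∀ i, IsFiniteMeasure (ν i)] [∀ i, NullSingletonClass (ν i)] :
    ∀ᵐ z ∂Measure.pi (fun a : Fin n × Fin m => ν a.1),
      Injective fun J : Fin n → Fin m => ∏ i, z (i, J i) := by
  have key : ∀ J J' : Fin n → Fin m, J ≠ J' → ∀ᵐ z ∂Measure.pi (fun a : Fin n × Fin m => ν a.1),
      ∏ i, z (i, J i) ≠ ∏ i, z (i, J' i) := by
    intro J J' hJ
    obtain ⟨i₀, hi₀⟩ := Function.ne_iff.1 hJ
    have hS : MeasurableSet {z : Fin n × Fin m → Circle |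
        ∏ i, z (i, J i) = ∏ i, z (i, J' i)} :=
      measurableSet_eq_fun (by fun_prop) (by fun_prop)
    -- The entry `(i₀, J i₀)` occurs in the first product only, so the equation determines it from
    -- the other entries.
    have := pi_null_of_subsingleton_update (fun a : Fin n × Fin m => ν a.1) (i₀, J i₀) hS ?_
    · simpa [ae_iff] using this
    intro y t ht t' ht'
    have hl : ∀ t, ∏ i, update y (i₀, J i₀) t (i, J i) =
        t * ∏ i ∈ Finset.univ.erase i₀, y (i, J i) := fun t => by
      rw [← Finset.mul_prod_erase _ _ (Finset.mem_univ i₀), update_self]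
      congr 1
      refine Finset.prod_congr rfl fun i hi => update_of_ne ?_ _ _
      exact fun h => Finset.ne_of_mem_erase hi (congrArg Prod.fst h)
    have hr : ∀ t, ∏ i, update y (i₀, J i₀) t (i, J' i) = ∏ i, y (i, J' i) := fun t => by
      refine Finset.prod_congr rfl fun i _ => update_of_ne (fun h => ?_) _ _
      obtain ⟨rfl, h2⟩ := Prod.mk.inj h
      exact hi₀ h2.symm
    simp only [mem_ofPred_eq, hl, hr] at ht ht'
    exact mul_right_cancel (ht.trans ht'.symm)
  have : ∀ᵐ z ∂Measure.pi (fun a : Fin n × Fin m => ν a.1), ∀ J J' : Fin n → Fin m, J ≠ J' →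
      ∏ i, z (i, J i) ≠ ∏ i, z (i, J' i) :=
    ae_all_iff.2 fun J => ae_all_iff.2 fun J' => by
      by_cases hJ : J = J'
      · simp [hJ]
      · exact (key J J' hJ).mono fun z hz _ => hz
  filter_upwards [this] with z hz J J' h
  by_contra hne
  exact hz J J' hne h

/-- If the points `x c` are block products of rearrangements of one and the same point, and are
distinct, then there are at most `(mk)! / (k!)ᵐ` of them. -/
theorem card_mul_factorial_pow_le {ι M : Type*} [Fintype ι] [CommMonoid M] {m k : ℕ}
    (z : Fin (m * k) → M) (ρ : ι → Equiv.Perm (Fin (m * k)))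
    (hρ : Injective fun c (j : Fin m) => ∏ l : Fin k, z (ρ c (finProdFinEquiv (j, l)))) :
    Fintype.card ι * k.factorial ^ m ≤ (m * k).factorial := by
  let b : (Fin m → Equiv.Perm (Fin k)) → Equiv.Perm (Fin (m * k)) := fun θ =>
    finProdFinEquiv.permCongr (Equiv.prodCongrRight θ)
  have hb : ∀ θ j l, b θ (finProdFinEquiv (j, l)) = finProdFinEquiv (j, θ j l) := fun θ j l => by
    simp only [b, Equiv.permCongr_apply, Equiv.symm_apply_apply]
    rfl
  -- Block products do not see `b θ`, so they recover `c`; cancelling `ρ c` then recovers `θ`.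
  have hinj : Injective fun p : ι × (Fin m → Equiv.Perm (Fin k)) => ρ p.1 * b p.2 := by
    rintro ⟨c, θ⟩ ⟨c', θ'⟩ h
    have hq : ∀ c θ, (fun j : Fin m => ∏ l : Fin k, z ((ρ c * b θ) (finProdFinEquiv (j, l)))) =
        fun j => ∏ l : Fin k, z (ρ c (finProdFinEquiv (j, l))) := fun c θ => by
      ext j
      simp only [Equiv.Perm.mul_apply, hb]
      exact Equiv.prod_comp (θ j) fun l => z (ρ c (finProdFinEquiv (j, l)))
    have hc : c = c' := hρ <| by
      simp only at h
      simp only [← hq c θ, ← hq c' θ', h]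
    subst hc
    have hθ : b θ = b θ' := mul_left_cancel h
    refine Prod.ext rfl (funext fun j => Equiv.ext fun l => ?_)
    have := congrArg (fun f => f (finProdFinEquiv (j, l))) hθ
    simp only [hb, EmbeddingLike.apply_eq_iff_eq, Prod.mk.injEq, true_and] at this
    exact this
  have := Fintype.card_le_of_injective _ hinj
  simpa [Fintype.card_perm] using this

/-- If almost every point of `𝕋ᵐᵏ` is determined by its product up to a permutation of its
coordinates, then `σ^{∗k}` is singular to convolutions of many continuous measures. -/
theorem CS_convPow_of_ae_determined (σ : Measure Circle) [IsFiniteMeasure σ] (m k n : ℕ)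
    {A : Set (Fin (m * k) → Circle)} (hA : ∀ᵐ z ∂Measure.pi (fun _ : Fin (m * k) => σ), z ∈ A)
    (hdet : ∀ z ∈ A, ∀ w ∈ A, ∏ a, z a = ∏ a, w a →
      ∃ ρ : Equiv.Perm (Fin (m * k)), ∀ a, w a = z (ρ a))
    (hn : (m * k).factorial < m.factorial ^ n * k.factorial ^ m) : CS n (convPow σ k) := by
  intro ν hfin hatom
  by_contra hns
  have : IsFiniteMeasure (convPow σ k) := conv.instIsFiniteMeasure _
  obtain ⟨B, hB, hBpos, hBac⟩ := exists_restrict_absolutelyContinuous _ _ hns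
  let q : (Fin (m * k) → Circle) → Fin m → Circle := fun z j => ∏ l, z (finProdFinEquiv (j, l))
  have hqlaw : (Measure.pi fun _ : Fin (m * k) => σ).map q =
      Measure.pi fun _ : Fin m => convPow σ k := pi_map_prod_curry finProdFinEquiv fun _ => σ
  have hqA : ∀ᵐ x ∂Measure.pi (fun _ : Fin m => convPow σ k), x ∈ q '' A := by
    rw [← hqlaw]
    exact ae_mem_image_of_continuous _ (by fun_prop) hA
  have hqB : ∀ᵐ x ∂Measure.pi (fun _ : Fin m => conv ν), (∀ j, x j ∈ B) → x ∈ q '' A := by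
    have : ∀ᵐ x ∂Measure.pi (fun _ : Fin m => (conv ν).restrict B), x ∈ q '' A :=
      (absolutelyContinuous_pi _ _ fun _ : Fin m => hBac).ae_le hqA
    rw [← Measure.restrict_pi_pi, ae_restrict_iff' (MeasurableSet.univ_pi fun _ => hB)] at this
    exact this.mono fun x hx h => hx fun j _ => h j
  set Q := Measure.pi (fun a : Fin n × Fin m => ν a.1)
  -- `e π` sends `(j, i)` to `(i, π i j)`: it partitions the array into `m` disjoint transversals,
  -- whose products are therefore independent of law `conv ν`.
  let e : (Fin n → Equiv.Perm (Fin m)) → Fin m × Fin n ≃ Fin n × Fin m := fun π =>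
    (Equiv.prodComm _ _).trans (Equiv.prodCongrRight π)
  have hx : ∀ᵐ z ∂Q, ∀ π : Fin n → Equiv.Perm (Fin m),
      (∀ j, ∏ i, z (i, π i j) ∈ B) → (fun j => ∏ i, z (i, π i j)) ∈ q '' A := by
    refine ae_all_iff.2 fun π => ?_
    have hlaw := pi_map_prod_curry (e π) fun a => ν a.1
    have : ∀ᵐ x ∂Q.map (fun z j => ∏ i, z (e π (j, i))), (∀ j, x j ∈ B) → x ∈ q '' A := by
      rw [hlaw]
      exact hqB
    exact ae_of_ae_map (Measurable.aemeasurable (by fun_prop)) this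
  have hgrid : Q {z | ∀ J : Fin n → Fin m, ∏ i, z (i, J i) ∈ B} ≠ 0 := by
    have hprod : Measurable fun x : Fin n → Circle => ∏ i, x i := by fun_prop
    have h1 : Measure.pi ν ((fun x => ∏ i, x i) ⁻¹' B) ≠ 0 := by
      rwa [← Measure.map_apply hprod hB]
    have h2 := pi_grid_ne_zero m ν (hprod hB) h1
    have h3 := pi_map_curry (Equiv.refl (Fin n × Fin m)) fun a => ν a.1
    simp only [Equiv.refl_apply] at h3
    rw [← h3, Measure.map_apply (by fun_prop) ?_] at h2
    · exact h2
    · simp only [ofPred_forall]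
      exact MeasurableSet.iInter fun J => (hprod hB).preimage (by fun_prop)
  obtain ⟨z, hzB, hzA, hzinj⟩ : ∃ z : Fin n × Fin m → Circle,
      (∀ J : Fin n → Fin m, ∏ i, z (i, J i) ∈ B) ∧
      (∀ π : Fin n → Equiv.Perm (Fin m),
        (∀ j, ∏ i, z (i, π i j) ∈ B) → (fun j => ∏ i, z (i, π i j)) ∈ q '' A) ∧
      Injective fun J : Fin n → Fin m => ∏ i, z (i, J i) := by
    have hfreq : ∃ᶠ z in ae Q, ∀ J : Fin n → Fin m, ∏ i, z (i, J i) ∈ B :=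
      frequently_ae_iff.2 hgrid
    obtain ⟨z, h1, h2, h3⟩ :=
      (hfreq.and_eventually (hx.and (ae_injective_prod_transversal ν))).exists
    exact ⟨z, h1, h2, h3⟩
  choose w hwA hw using fun π => hzA π fun j => hzB _
  -- Every family of transversals exhausts the array, so the total product does not depend on `π`.
  have hwprod : ∀ π, ∏ a, w π a = ∏ a, z a := fun π => by
    rw [← (e π).prod_comp z, ← finProdFinEquiv.prod_comp (w π), Fintype.prod_prod_type,
      Fintype.prod_prod_type]
    exact Finset.prod_congr rfl fun j _ => congrFun (hw π) j
  -- The lift for the identity tuple serves as the common reference point.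
  choose ρ hρ using fun π => hdet (w 1) (hwA 1) (w π) (hwA π) ((hwprod 1).trans (hwprod π).symm)
  refine hn.not_ge ?_
  have := card_mul_factorial_pow_le (w 1) ρ ?_
  · simpa [Fintype.card_perm] using this
  intro π π' h
  simp only [← hρ] at h
  have h' : (fun j => ∏ i, z (i, π i j)) = fun j => ∏ i, z (i, π' i j) :=
    (hw π).symm.trans (h.trans (hw π'))
  refine funext fun i => Equiv.ext fun j => ?_
  exact congrFun (hzinj (congrFun h' j)) i

/-! ### Tensor powers of `L²` as functions of several variables -/

section TensorLp

variable {X : Type*} [MeasurableSpace X] (σ : Measure X) [IsFiniteMeasure σ] (N : ℕ)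

theorem memLp_prod_eval {N : ℕ} (f : Fin N → Lp ℂ 2 σ) :
    MemLp (fun z : Fin N → X => ∏ i, f i (z i)) 2 (Measure.pi fun _ => σ) := by
  have hm : AEStronglyMeasurable (fun z : Fin N → X => ∏ i, f i (z i))
      (Measure.pi fun _ => σ) := by
    refine Finset.aestronglyMeasurable_fun_prod _ fun i _ => ?_
    exact (Lp.aestronglyMeasurable (f i)).comp_quasiMeasurePreserving
      (Measure.quasiMeasurePreserving_eval (fun _ => σ) i)
  rw [memLp_two_iff_integrable_sq_norm hm]
  simp only [norm_prod, ← Finset.prod_pow]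
  exact Integrable.fintype_prod fun i =>
    (memLp_two_iff_integrable_sq_norm (Lp.aestronglyMeasurable (f i))).1 (Lp.memLp (f i))

/-- The function `z ↦ ∏ᵢ fᵢ(zᵢ)` as an element of `L²`, as a multilinear map in the `fᵢ`. -/
def prodEvalLp : MultilinearMap ℂ (fun _ : Fin N => Lp ℂ 2 σ)
    (Lp ℂ 2 (Measure.pi fun _ : Fin N => σ)) where
  toFun f := (memLp_prod_eval σ f).toLp _
  map_update_add' := by
    intro _ f i a b
    apply Lp.ext
    filter_upwards [MemLp.coeFn_toLp (memLp_prod_eval σ (update f i (a + b))),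
      MemLp.coeFn_toLp (memLp_prod_eval σ (update f i a)),
      MemLp.coeFn_toLp (memLp_prod_eval σ (update f i b)),
      Lp.coeFn_add ((memLp_prod_eval σ (update f i a)).toLp _)
        ((memLp_prod_eval σ (update f i b)).toLp _),
      Measure.tendsto_eval_ae_ae.eventually (Lp.coeFn_add a b)] with z h1 h2 h3 h4 h5
    rw [h4, Pi.add_apply, h1, h2, h3]
    simp only [apply_update fun j (g : Lp ℂ 2 σ) => g (z j),
      Finset.prod_update_of_mem (Finset.mem_univ i)]
    rw [← add_mul]
    exact congrArg (· * _) h5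
  map_update_smul' := by
    intro _ f i c a
    apply Lp.ext
    filter_upwards [MemLp.coeFn_toLp (memLp_prod_eval σ (update f i (c • a))),
      MemLp.coeFn_toLp (memLp_prod_eval σ (update f i a)),
      Lp.coeFn_smul c ((memLp_prod_eval σ (update f i a)).toLp _),
      Measure.tendsto_eval_ae_ae.eventually (Lp.coeFn_smul c a)] with z h1 h2 h3 h4
    rw [h3, Pi.smul_apply, h1, h2]
    simp only [apply_update fun j (g : Lp ℂ 2 σ) => g (z j),
      Finset.prod_update_of_mem (Finset.mem_univ i)]
    rw [smul_eq_mul, ← mul_assoc]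
    exact congrArg (· * _) h4

theorem coeFn_prodEvalLp (f : Fin N → Lp ℂ 2 σ) :
    prodEvalLp σ N f =ᵐ[Measure.pi fun _ => σ] fun z => ∏ i, f i (z i) :=
  MemLp.coeFn_toLp (memLp_prod_eval σ f)

/-- Fubini factors the integral; this is what makes the tensor power embed isometrically in `L²` of
the product measure. -/
theorem inner_prodEvalLp (f g : Fin N → Lp ℂ 2 σ) :
    inner ℂ (prodEvalLp σ N f) (prodEvalLp σ N g) = ∏ i, inner ℂ (f i) (g i) := by
  simp only [L2.inner_def]
  rw [← integral_fintype_prod_eq_prod]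
  refine integral_congr_ae ?_
  filter_upwards [coeFn_prodEvalLp σ N f, coeFn_prodEvalLp σ N g] with z hf hg
  rw [hf, hg]
  simp only [RCLike.inner_apply, map_prod, Finset.prod_mul_distrib]

/-- The linear map `f₁ ⊗ ⋯ ⊗ f_N ↦ ∏ᵢ fᵢ(zᵢ)` on the algebraic tensor power. -/
def algTensorLp : AlgTensor N (Lp ℂ 2 σ) →ₗ[ℂ] Lp ℂ 2 (Measure.pi fun _ : Fin N => σ) :=
  PiTensorProduct.lift (prodEvalLp σ N)

theorem algTensorLp_tmul (f : Fin N → Lp ℂ 2 σ) :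
    algTensorLp σ N (AlgTensor.tmul f) = prodEvalLp σ N f :=
  PiTensorProduct.lift.tprod f

/-- By sesquilinearity simple tensors suffice. The bound allows the extension to the completion;
surjectivity onto `L²` is never needed. -/
theorem norm_algTensorLp (t : AlgTensor N (Lp ℂ 2 σ)) : ‖algTensorLp σ N t‖ = ‖t‖ := by
  have key : ∀ s t : AlgTensor N (Lp ℂ 2 σ),
      inner ℂ (algTensorLp σ N s) (algTensorLp σ N t) = inner ℂ s t := by
    intro s t
    induction s using AlgTensor.induction with
    | smul_tmul c x =>
      induction t using AlgTensor.induction with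
      | smul_tmul d y =>
        simp only [map_smul, inner_smul_left, inner_smul_right, algTensorLp_tmul,
          inner_prodEvalLp, AlgTensor.inner_tmul]
      | add s t hs ht => simp only [map_add, inner_add_right, hs, ht]
    | add s t hs ht => simp only [map_add, inner_add_left, hs, ht]
  rw [norm_eq_sqrt_re_inner (𝕜 := ℂ), norm_eq_sqrt_re_inner (𝕜 := ℂ), key]

/-- The continuous linear map `f₁ ⊗ ⋯ ⊗ f_N ↦ ∏ᵢ fᵢ(zᵢ)` on the Hilbert space tensor power. -/
def tensorLp : HilbertTensor N (Lp ℂ 2 σ) →L[ℂ] Lp ℂ 2 (Measure.pi fun _ : Fin N => σ) :=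
  ((algTensorLp σ N).mkContinuous 1 fun t => by rw [norm_algTensorLp, one_mul]).extend
    UniformSpace.Completion.toComplL

theorem tensorLp_coe (t : AlgTensor N (Lp ℂ 2 σ)) :
    tensorLp σ N (t : HilbertTensor N (Lp ℂ 2 σ)) = algTensorLp σ N t :=
  ContinuousLinearMap.extend_eq _ UniformSpace.Completion.denseRange_coe
    (UniformSpace.Completion.isUniformInducing_coe _) t

end TensorLp

/-! ### The operator `V_σ ⊗ ⋯ ⊗ V_σ` as a multiplication operator -/

section Multiplication

variable (σ : Measure Circle) (N : ℕ)

theorem memLp_top_prod_coe :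
    MemLp (fun z : Fin N → Circle => ∏ i, (z i : ℂ)) ⊤ (Measure.pi fun _ => σ) := by
  refine memLp_top_of_bound (Continuous.aestronglyMeasurable (by fun_prop)) 1
    (ae_of_all _ fun z => ?_)
  rw [norm_prod]
  exact (Finset.prod_eq_one fun i _ => Circle.norm_coe (z i)).le

/-- Multiplication by `z₁ ⋯ z_N`. -/
def mulProd : Lp ℂ 2 (Measure.pi fun _ : Fin N => σ) →L[ℂ] Lp ℂ 2 (Measure.pi fun _ : Fin N => σ) :=
  (ContinuousLinearMap.mul ℂ ℂ).holderL _ ⊤ 2 2 ((memLp_top_prod_coe σ N).toLp _)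

theorem coeFn_mulProd (f : Lp ℂ 2 (Measure.pi fun _ : Fin N => σ)) :
    mulProd σ N f =ᵐ[Measure.pi fun _ => σ] fun z => (∏ i, (z i : ℂ)) * f z := by
  filter_upwards [(ContinuousLinearMap.mul ℂ ℂ).coeFn_holder (r := 2)
    ((memLp_top_prod_coe σ N).toLp _) f, MemLp.coeFn_toLp (memLp_top_prod_coe σ N)] with z h1 h2
  refine Eq.trans h1 ?_
  rw [h2, ContinuousLinearMap.mul_apply']

variable [IsFiniteMeasure σ]

/-- Both sides are continuous and linear, so simple tensors suffice, where each factor contributes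
its own `zᵢ`. -/
theorem tensorLp_tensorPow (t : HilbertTensor N (Lp ℂ 2 σ)) :
    tensorLp σ N (tensorPow (V σ) N t) = mulProd σ N (tensorLp σ N t) := by
  induction t using UniformSpace.Completion.induction_on with
  | hp =>
    exact isClosed_eq ((tensorLp σ N).continuous.comp (tensorPow (V σ) N).continuous)
      ((mulProd σ N).continuous.comp (tensorLp σ N).continuous)
  | ih t =>
    rw [tensorPow, extendCompletion_coe, tensorLp_coe, tensorLp_coe]
    induction t using AlgTensor.induction with
    | smul_tmul c f =>
      simp only [map_smul, AlgTensor.map_tmul, algTensorLp_tmul]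
      congr 1
      apply Lp.ext
      have hV : ∀ᵐ z ∂Measure.pi (fun _ : Fin N => σ), ∀ i, V σ (f i) (z i) = z i * f i (z i) :=
        ae_all_iff.2 fun i =>
          (Measure.quasiMeasurePreserving_eval (fun _ => σ) i).ae (V_apply σ (f i))
      filter_upwards [coeFn_prodEvalLp σ N fun i => V σ (f i), coeFn_prodEvalLp σ N f,
        coeFn_mulProd σ N (prodEvalLp σ N f), hV] with z h1 h2 h3 h4
      rw [h1, h3, h2, ← Finset.prod_mul_distrib]
      exact Finset.prod_congr rfl fun i _ => h4 i
    | add s t hs ht => simp only [map_add, hs, ht]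

theorem coeFn_tensorLp_symPow_zpow (x : symTensor N (Lp ℂ 2 σ)) (j : ℤ) :
    tensorLp σ N ((symPow (V σ) N ^ j) x : symTensor N (Lp ℂ 2 σ)) =ᵐ[Measure.pi fun _ => σ]
      fun z => (∏ i, (z i : ℂ)) ^ j * tensorLp σ N x z := by
  have hstep : ∀ y : symTensor N (Lp ℂ 2 σ),
      tensorLp σ N (symPow (V σ) N y : symTensor N (Lp ℂ 2 σ)) =ᵐ[Measure.pi fun _ => σ]
        fun z => (∏ i, (z i : ℂ)) * tensorLp σ N y z := fun y => by
    have : ((symPow (V σ) N y : symTensor N (Lp ℂ 2 σ)) : HilbertTensor N (Lp ℂ 2 σ)) =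
      tensorPow (V σ) N y := rfl
    rw [this, tensorLp_tensorPow]
    exact coeFn_mulProd σ N _
  have hne : ∀ z : Fin N → Circle, ∏ i, (z i : ℂ) ≠ 0 := fun z =>
    Finset.prod_ne_zero_iff.2 fun i _ => Circle.coe_ne_zero (z i)
  induction j using Int.induction_on with
  | zero => exact ae_of_all _ fun z => by simp
  | succ j ih =>
    have h := hstep ((symPow (V σ) N ^ (j : ℤ)) x)
    rw [show symPow (V σ) N ((symPow (V σ) N ^ (j : ℤ)) x) =
      (symPow (V σ) N ^ ((j : ℤ) + 1)) x by rw [add_comm, zpow_one_add]; rfl] at h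
    filter_upwards [h, ih] with z h1 h2
    rw [h1, h2, zpow_add_one₀ (hne z)]
    ring
  | pred j ih =>
    -- For negative powers, apply one forward step to the next power down and cancel the
    -- nonvanishing product.
    have h := hstep ((symPow (V σ) N ^ (-(j : ℤ) - 1)) x)
    rw [show symPow (V σ) N ((symPow (V σ) N ^ (-(j : ℤ) - 1)) x) =
      (symPow (V σ) N ^ (-(j : ℤ))) x by
        rw [show -(j : ℤ) = 1 + (-(j : ℤ) - 1) by ring, zpow_one_add]; simp] at h
    filter_upwards [h, ih] with z h1 h2
    rw [h2] at h1
    refine mul_left_cancel₀ (hne z) (h1.symm.trans ?_)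
    rw [← mul_assoc, ← zpow_one_add₀ (hne z), add_sub_cancel]

end Multiplication

/-! ### Simple spectrum -/

/-- Index 0 is always counted by the multiplicity, since `dμ₀/dμ₀ = 1` a.e. Multiplicity one thus
forces `μ i = 0` for `i ≠ 0`, and the total mass of `μ i` is `‖x i‖²`. -/
theorem HasSimpleSpectrum.exists_cyclicSpace_eq_top {H : Type*} [NormedAddCommGroup H]
    [InnerProductSpace ℂ H] {U : H ≃ₗᵢ[ℂ] H} (h : HasSimpleSpectrum U) :
    ∃ x, cyclicSpace U x = ⊤ := by
  obtain ⟨x, μ, hd, hmult⟩ := h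
  have hfin : ∀ i, IsFiniteMeasure (μ i) := fun i => (hd.spectral i).finite
  have hac : ∀ i, μ i ≪ μ 0 := fun i => by
    induction i with
    | zero => exact Measure.AbsolutelyContinuous.rfl
    | succ i ih => exact (hd.chain i).trans ih
  have hμ : ∀ i, i ≠ 0 → μ i = 0 := fun i hi => by
    rw [← Measure.withDensity_rnDeriv_eq _ _ (hac i), ← withDensity_zero]
    refine withDensity_congr_ae ?_
    filter_upwards [hmult, Measure.rnDeriv_self (μ 0)] with z hz h0
    by_contra hne
    obtain ⟨a, ha⟩ := encard_eq_one.1 (hz.trans Nat.cast_one)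
    have h1 : i ∈ ({a} : Set ℕ) := ha ▸ hne
    have h2 : 0 ∈ ({a} : Set ℕ) := ha ▸ (by simp [h0] : (μ 0).rnDeriv (μ 0) z ≠ 0)
    exact hi ((mem_singleton_iff.1 h1).trans (mem_singleton_iff.1 h2).symm)
  have hx : ∀ i, i ≠ 0 → x i = 0 := fun i hi => by
    have := (hd.spectral i).fourier 0
    simpa [hμ i hi] using this
  refine ⟨x 0, ?_⟩
  have hle : ∀ i, cyclicSpace U (x i) ≤ cyclicSpace U (x 0) := fun i => by
    rcases eq_or_ne i 0 with rfl | hi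
    · exact le_rfl
    · refine Submodule.topologicalClosure_minimal _ (Submodule.span_le.2 ?_)
        (Submodule.isClosed_topologicalClosure _)
      rintro _ ⟨j, rfl⟩
      simp [hx i hi]
  refine top_unique (hd.total ▸ ?_)
  exact Submodule.topologicalClosure_minimal _ (iSup_le hle)
    (Submodule.isClosed_topologicalClosure _)

/-- Two polynomials agreeing at all natural numbers are equal, hence have the same roots with
multiplicity. Matching the fibres over each root gives the permutation. -/
theorem exists_perm_of_prod_sub_eq {N : ℕ} (z w : Fin N → ℂ)
    (h : ∀ c : ℕ, ∏ i, ((c : ℂ) - z i) = ∏ i, ((c : ℂ) - w i)) :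
    ∃ ρ : Equiv.Perm (Fin N), ∀ i, w i = z (ρ i) := by
  open Polynomial in
  have hpoly : ∏ i, (X - C (z i)) = ∏ i, (X - C (w i)) := by
    refine Polynomial.eq_of_infinite_eval_eq _ _
      ((Set.infinite_range_of_injective (Nat.cast_injective (R := ℂ))).mono ?_)
    rintro _ ⟨c, rfl⟩
    simpa [Polynomial.eval_prod] using h c
  have hroots : ∀ u : Fin N → ℂ, (∏ i, (Polynomial.X - Polynomial.C (u i))).roots =
      Finset.univ.val.map u := fun u => by
    rw [Finset.prod, ← Polynomial.roots_multiset_prod_X_sub_C (Finset.univ.val.map u),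
      Multiset.map_map]
    rfl
  have hm : Finset.univ.val.map w = Finset.univ.val.map z := by
    rw [← hroots, ← hroots, hpoly]
  have hcard : ∀ a, Fintype.card {i // w i = a} = Fintype.card {i // z i = a} := fun a => by
    have := congrArg (Multiset.count a) hm
    simp only [Multiset.count_map] at this
    simp only [Fintype.card_subtype, eq_comm (b := a)]
    exact this
  exact ⟨Equiv.ofFiberEquiv fun a => Fintype.equivOfCardEq (hcard a),
    fun i => (Equiv.ofFiberEquiv_map _ i).symm⟩

/-- If `V_σ^{⊙N}` has simple spectrum, then almost every point of `𝕋ᴺ` is determined by the product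
of its coordinates up to a permutation. -/
theorem HasSimpleSpectrum.exists_ae_determined (σ : Measure Circle) [IsFiniteMeasure σ] (N : ℕ)
    (h : HasSimpleSpectrum (symPow (V σ) N)) :
    ∃ A : Set (Fin N → Circle), (∀ᵐ z ∂Measure.pi (fun _ : Fin N => σ), z ∈ A) ∧
      ∀ z ∈ A, ∀ w ∈ A, ∏ i, z i = ∏ i, w i → ∃ ρ : Equiv.Perm (Fin N), ∀ i, w i = z (ρ i) := by
  obtain ⟨x, hx⟩ := h.exists_cyclicSpace_eq_top
  set μ := Measure.pi fun _ : Fin N => σ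
  set g : Lp ℂ 2 μ := tensorLp σ N x
  have hcoe : ∀ z : Fin N → Circle, ((∏ i, z i : Circle) : ℂ) = ∏ i, (z i : ℂ) := fun z =>
    map_prod Circle.coeHom z Finset.univ
  -- Only the factored shape matters, so `P` may be an arbitrary function and no regularity is
  -- recorded.
  have hspan : ∀ y ∈ Submodule.span ℂ (range fun j : ℤ => (symPow (V σ) N ^ j) x),
      ∃ P : Circle → ℂ, tensorLp σ N (y : symTensor N (Lp ℂ 2 σ)) =ᵐ[μ]
        fun z => P (∏ i, z i) * g z := fun y hy => by
    induction hy using Submodule.span_induction with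
    | mem y hy =>
      obtain ⟨j, rfl⟩ := hy
      refine ⟨fun p => (p : ℂ) ^ j, (coeFn_tensorLp_symPow_zpow σ N x j).mono fun z hz => ?_⟩
      refine hz.trans ?_
      simp only [hcoe]
      rfl
    | zero =>
      refine ⟨0, ?_⟩
      simp only [ZeroMemClass.coe_zero, map_zero, Pi.zero_apply, zero_mul]
      exact Lp.coeFn_zero ℂ 2 μ
    | add y y' _ _ hy hy' =>
      obtain ⟨P, hP⟩ := hy
      obtain ⟨P', hP'⟩ := hy'
      refine ⟨P + P', ?_⟩
      rw [Submodule.coe_add, map_add]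
      filter_upwards [hP, hP', Lp.coeFn_add (tensorLp σ N y) (tensorLp σ N y')] with z h1 h2 h3
      rw [h3, Pi.add_apply, h1, h2, Pi.add_apply, add_mul]
    | smul c y _ hy =>
      obtain ⟨P, hP⟩ := hy
      refine ⟨c • P, ?_⟩
      rw [Submodule.coe_smul, map_smul]
      filter_upwards [hP, Lp.coeFn_smul c (tensorLp σ N y)] with z h1 h2
      rw [h2, Pi.smul_apply, h1, Pi.smul_apply, smul_eq_mul, smul_eq_mul, mul_assoc]
  have hlim : ∀ y : symTensor N (Lp ℂ 2 σ), ∃ P : ℕ → Circle → ℂ, ∀ᵐ z ∂μ,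
      Tendsto (fun l => P l (∏ i, z i) * g z) atTop (𝓝 (tensorLp σ N y z)) := fun y => by
    have hy : y ∈ closure (Submodule.span ℂ
        (range fun j : ℤ => (symPow (V σ) N ^ j) x) : Set (symTensor N (Lp ℂ 2 σ))) := by
      rw [← Submodule.topologicalClosure_coe]
      exact (hx ▸ Submodule.mem_top : y ∈ cyclicSpace (symPow (V σ) N) x)
    obtain ⟨s, hs, hsy⟩ := mem_closure_iff_seq_limit.1 hy
    choose P hP using fun l => hspan (s l) (hs l)
    have ht : Tendsto (fun l => tensorLp σ N (s l)) atTop (𝓝 (tensorLp σ N y)) :=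
      (((tensorLp σ N).continuous.comp continuous_subtype_val).tendsto y).comp hsy
    -- `L²` convergence yields a.e. convergence along a subsequence, which may depend on `y`.
    obtain ⟨φ, -, hφ⟩ := (tendstoInMeasure_of_tendsto_Lp ht).exists_seq_tendsto_ae
    refine ⟨fun l => P (φ l), ?_⟩
    filter_upwards [hφ, ae_all_iff.2 hP] with z h1 h2
    simpa only [h2] using h1
  have hF : ∀ c : ℕ, MemLp (fun z : Circle => (c : ℂ) - z) 2 σ := fun c =>
    MemLp.of_bound (Continuous.aestronglyMeasurable (by fun_prop)) (c + 1) <| ae_of_all _ fun z =>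
      (norm_sub_le _ _).trans (by rw [Circle.norm_coe]; simp)
  let y : ℕ → symTensor N (Lp ℂ 2 σ) := fun c =>
    ⟨((AlgTensor.tmul fun _ => (hF c).toLp _ : AlgTensor N (Lp ℂ 2 σ)) : HilbertTensor N _),
      fun π => by rw [permOp, extendCompletion_coe, AlgTensor.perm_tmul]⟩
  have hy : ∀ c, tensorLp σ N (y c) =ᵐ[μ] fun z => ∏ i, ((c : ℂ) - z i) := fun c => by
    have h1 : ∀ᵐ z ∂μ, ∀ i, (hF c).toLp _ (z i) = (c : ℂ) - z i :=
      ae_all_iff.2 fun i =>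
        (Measure.quasiMeasurePreserving_eval (fun _ => σ) i).ae (MemLp.coeFn_toLp (hF c))
    simp only [y, tensorLp_coe, algTensorLp_tmul]
    filter_upwards [coeFn_prodEvalLp σ N fun _ => (hF c).toLp _, h1] with z h2 h3
    rw [h2]
    exact Finset.prod_congr rfl fun i _ => h3 i
  choose P hP using fun c => hlim (y c)
  -- Countably many values of `c` keep this set of full measure.
  refine ⟨{z | ∀ c : ℕ, Tendsto (fun l => P c l (∏ i, z i) * g z) atTop
    (𝓝 (∏ i, ((c : ℂ) - z i)))}, ?_, fun z hz w hw hzw => ?_⟩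
  · filter_upwards [ae_all_iff.2 hP, ae_all_iff.2 hy] with z h1 h2 c
    rw [← h2 c]
    exact h1 c
  have hzw' : ∏ i, (z i : ℂ) = ∏ i, (w i : ℂ) := by
    rw [← hcoe, ← hcoe, hzw]
  have hne : ∀ z : Fin N → Circle, ∏ i, (((0 : ℕ) : ℂ) - z i) ≠ 0 := fun z =>
    Finset.prod_ne_zero_iff.2 fun i _ => by simp
  have hg : ∀ z, (∀ c : ℕ, Tendsto (fun l => P c l (∏ i, z i) * g z) atTop
      (𝓝 (∏ i, ((c : ℂ) - z i)))) → g z ≠ 0 := fun z hz h0 => by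
    have := hz 0
    simp only [h0, mul_zero] at this
    exact hne z (tendsto_nhds_unique this tendsto_const_nhds)
  -- Both quotients are limits of the same sequence `P c l p`, as the two points share the product
  -- `p`.
  have hdiv : ∀ c : ℕ, (∏ i, ((c : ℂ) - z i)) / g z = (∏ i, ((c : ℂ) - w i)) / g w := fun c => by
    have h1 := (hz c).div_const (g z)
    have h2 := (hw c).div_const (g w)
    simp only [mul_div_cancel_right₀ _ (hg z hz)] at h1
    simp only [mul_div_cancel_right₀ _ (hg w hw), ← hzw] at h2
    exact tendsto_nhds_unique h1 h2
  -- At `c = 0` both products are `(-1)^N p ≠ 0`, which forces equal normalisations.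
  have hgzw : g z = g w := by
    have h0 := hdiv 0
    have : ∏ i, (((0 : ℕ) : ℂ) - z i) = ∏ i, (((0 : ℕ) : ℂ) - w i) := by
      simp [Finset.prod_neg, hzw']
    rw [this] at h0
    rw [div_eq_div_iff (hg z hz) (hg w hw)] at h0
    exact (mul_left_cancel₀ (hne w) h0).symm
  obtain ⟨ρ, hρ⟩ := exists_perm_of_prod_sub_eq (fun i => (z i : ℂ)) (fun i => (w i : ℂ)) fun c => by
    have := hdiv c
    rwa [hgzw, div_left_inj' (hg w hw)] at this
  exact ⟨ρ, fun i => Circle.ext (hρ i)⟩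

end ConvSing

end

theorem mainTheorem4 (σ : MeasureTheory.Measure Circle) [MeasureTheory.IsFiniteMeasure σ]
    [MeasureTheory.NullSingletonClass σ] (m k : ℕ) (hm : 1 ≤ m) (hk : 1 ≤ k)
    (hsimple : ConvSing.HasSimpleSpectrum (ConvSing.symPow (ConvSing.V σ) (m * k)))
    (n : ℕ)
    (hn : ((m * k).factorial : ℝ) / (k.factorial : ℝ) ^ m < (m.factorial : ℝ) ^ n) :
    ConvSing.CS n (ConvSing.convPow σ k) := by
  obtain ⟨A, hA, hdet⟩ := hsimple.exists_ae_determined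
  refine ConvSing.CS_convPow_of_ae_determined σ m k n hA hdet ?_
  rw [div_lt_iff₀ (by positivity)] at hn
  exact_mod_cast hn
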